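/- Let $\mathcal C$ be a category and $\mathcal M$ a class of monomorphisms of $\mathcal C$ such that $(\mathcal C,\mathcal M)$ is a weak adhesive HLR category, that is: $\mathcal M$ contains all isomorphisms and is closed under composition and decomposition ($g\circ f\in\mathcal M$ and $g\in\mathcal M$ imply $f\in\mathcal M$); $\mathcal C$ has pushouts and pullbacks along $\mathcal M$-morphisms and $\mathcal M$ is closed under pushouts and pullbacks; and for every pushout $C\xleftarrow{f}A\xrightarrow{m}B$, $C\to D\leftarrow B$ with $m\in\mathcal M$, and every commutative cube with this square as bottom face, whose back faces (those over $f$ and $m$) are pullbacks, and in which $f\in\mathcal M$ or the vertical morphisms over $B$, $C$ and $D$ are all in $\mathcal M$, the top face is a pushout if and only if both front faces are pullbacks. Assume that $\mathcal C$ has binary coproducts compatible with $\mathcal M$, i.e. $f+g\in\mathcal M$ whenever $f,g\in\mathcal M$. A weak span $\rho$ is a diagram $L\xleftarrow{l}K\xleftarrow{i}I\xrightarrow{r}R$ in $\mathcal C$; it is an $\mathcal M$-weak span if $l,i,r\in\mathcal M$. A direct transformation $\gamma\in\Delta_G(\rho)$ of an object $G$ consists of objects $D,H$ and morphisms $m:L\to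 G$, $k:K\to D$, $f:D\to G$, $g:D\to H$, $n:R\to H$ such that $(G,f,m)$ is a pushout over $(l,k)$ and $(H,g,n)$ is a pushout over $(r,k\circ i)$; one writes $G\Rightarrow_\gamma H$. Data belonging to $\rho_a,\gamma_a$ carry the index $a$. Direct transformations $\gamma_1\in\Delta_G(\rho_1)$ and $\gamma_2\in\Delta_G(\rho_2)$ are parallel independent if there are $j_1:L_1\to D_2$ and $j_2:L_2\to D_1$ with $f_2\circ j_1=m_1$ and $f_1\circ j_2=m_2$. They are parallel coherent if there are $j_1:I_1\to D_2$ and $j_2:I_2\to D_1$ with $f_2\circ j_1=f_1\circ k_1\circ i_1$ and $f_1\circ j_2=f_2\circ k_2\circ i_2$. For a nonempty finite family $\Gamma=(\gamma_1,\dots,\gamma_p)$ of pairwise parallel coherent direct transformations of $G$, one writes $G\Rightarrow_\Gamma H'$ if there are morphisms $j_a^b:I_a\to D_b$ with $j_a^a=k_a\circ i_a$ and $f_b\circ j_a^b=f_a\circ k_a\circ i_a$ for all $a,b$; a limit $(D',e_1,\dots,e_p)$ over $(f_1,\dots,f_p)$, with the induced morphisms $d_a:I_a\to D'$ given by $e_b\circ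 d_a=j_a^b$ for all $b$; pushouts $(H'_a,g'_a,n'_a)$ over $(r_a,d_a)$ for all $a$; and a colimit $(H',h_1,\dots,h_p)$ over $(g'_1,\dots,g'_p)$. Corollary. Let $\rho_1,\rho_2$ be $\mathcal M$-weak spans, $G,H'$ objects of $\mathcal C$, and let $\gamma_1\in\Delta_G(\rho_1)$ and $\gamma_2\in\Delta_G(\rho_2)$ be parallel independent, with $G\Rightarrow_{\gamma_1}H_1$. If $G\Rightarrow_\Gamma H'$ for the two-member family $\Gamma=(\gamma_1,\gamma_2)$, then there is $\gamma'_2\in\Delta_{H_1}(\rho_2)$ such that $H_1\Rightarrow_{\gamma'_2}H'$; thus $G\Rightarrow_{\gamma_1}H_1\Rightarrow_{\gamma'_2}H'$. -/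

import Mathlib

open CategoryTheory CategoryTheory.Limits

namespace WeakSpans

universe v u

variable {C : Type u} [Category.{v} C]

/-- A pushout square `f ≫ h = g ≫ i` is a *weak van Kampen square* with respect to `M` (in the
direction of `f`) if the van Kampen property holds for all commutative cubes over it in which
`f` is in `M` and, moreover, `g` is in `M` or the three vertical morphisms
`αX`, `αY`, `αZ` are in `M`. The hypothesis `M f` is imposed where this is used. -/
def IsWeakVanKampen (M : MorphismProperty C) {W X Y Z : C}
    (f : W ⟶ X) (g : W ⟶ Y) (h : X ⟶ Z) (i : Y ⟶ Z) : Prop :=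
  ∀ ⦃W₁ X₁ Y₁ Z₁ : C⦄ (f₁ : W₁ ⟶ X₁) (g₁ : W₁ ⟶ Y₁) (h₁ : X₁ ⟶ Z₁) (i₁ : Y₁ ⟶ Z₁)
    (αW : W₁ ⟶ W) (αX : X₁ ⟶ X) (αY : Y₁ ⟶ Y) (αZ : Z₁ ⟶ Z),
    IsPullback f₁ αW αX f → IsPullback g₁ αW αY g →
    CommSq h₁ αX αZ h → CommSq i₁ αY αZ i → CommSq f₁ g₁ h₁ i₁ →
    (M g ∨ (M αX ∧ M αY ∧ M αZ)) →
    (IsPushout f₁ g₁ h₁ i₁ ↔ IsPullback h₁ αX αZ h ∧ IsPullback i₁ αY αZ i)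

/-- `(C, M)` is a *weak adhesive HLR category*. -/
structure IsWeakAdhesiveHLR (M : MorphismProperty C) : Prop where
  mono : ∀ {X Y : C} (f : X ⟶ Y), M f → Mono f
  of_isIso : ∀ {X Y : C} (f : X ⟶ Y), IsIso f → M f
  comp : ∀ {X Y Z : C} (f : X ⟶ Y) (g : Y ⟶ Z), M f → M g → M (f ≫ g)
  decomp : ∀ {X Y Z : C} (f : X ⟶ Y) (g : Y ⟶ Z), M (f ≫ g) → M g → M f
  hasPushout : ∀ {X Y Z : C} (f : X ⟶ Y) (g : X ⟶ Z), M f → HasPushout f g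
  hasPullback : ∀ {X Y Z : C} (f : X ⟶ Z) (g : Y ⟶ Z), M f → HasPullback f g
  stable_cobaseChange : M.IsStableUnderCobaseChange
  stable_baseChange : M.IsStableUnderBaseChange
  weakVanKampen : ∀ {W X Y Z : C} (f : W ⟶ X) (g : W ⟶ Y) (h : X ⟶ Z) (i : Y ⟶ Z),
    IsPushout f g h i → M f → IsWeakVanKampen M f g h i

/-- Binary coproducts are *compatible with `M`*: `f + g` is in `M` whenever `f` and `g` are. -/
def CoproductsCompatible [HasBinaryCoproducts C] (M : MorphismProperty C) : Prop :=
  ∀ {A₁ A₂ B₁ B₂ : C} (f : A₁ ⟶ B₁) (g : A₂ ⟶ B₂), M f → M g → M (coprod.map f g)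

variable (C) in
/-- A *weak span* `L ⟵ K ⟵ I ⟶ R`. -/
structure WeakSpan where
  {L K I R : C}
  l : K ⟶ L
  i : I ⟶ K
  r : I ⟶ R

/-- An *`M`-weak span*: a weak span whose three morphisms are in `M`. -/
structure WeakSpan.In (ρ : WeakSpan C) (M : MorphismProperty C) : Prop where
  l : M ρ.l
  i : M ρ.i
  r : M ρ.r

/-- A *direct transformation* of `G` by `ρ` (a weak double-pushout):
```
L <-l- K <-i- I -r-> R
|      |      |      |
m      k    k ∘ i    n
v      v      v      v
G <-f- D  ==  D -g-> H
```
with both squares pushouts. The type `DirectTransformation ρ G` is the set `Δ_G(ρ)`. -/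
structure DirectTransformation (ρ : WeakSpan C) (G : C) where
  {D H : C}
  m : ρ.L ⟶ G
  k : ρ.K ⟶ D
  f : D ⟶ G
  g : D ⟶ H
  n : ρ.R ⟶ H
  left_po : IsPushout ρ.l k m f
  right_po : IsPushout ρ.r (ρ.i ≫ k) n g

/-- `γ.Yields H` is `G ⇒_γ H`. -/
def DirectTransformation.Yields {ρ : WeakSpan C} {G : C}
    (γ : DirectTransformation ρ G) (H : C) : Prop :=
  γ.H = H

/-- Direct transformations of `G` by arbitrary weak spans (a disjoint union over weak spans). -/
abbrev Step (G : C) := Σ ρ : WeakSpan C, DirectTransformation ρ G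

/-- `γ₁` and `γ₂` are *parallel coherent*. -/
def ParallelCoherent {ρ₁ ρ₂ : WeakSpan C} {G : C}
    (γ₁ : DirectTransformation ρ₁ G) (γ₂ : DirectTransformation ρ₂ G) : Prop :=
  ∃ (j₁ : ρ₁.I ⟶ γ₂.D) (j₂ : ρ₂.I ⟶ γ₁.D),
    j₁ ≫ γ₂.f = ρ₁.i ≫ γ₁.k ≫ γ₁.f ∧ j₂ ≫ γ₁.f = ρ₂.i ≫ γ₂.k ≫ γ₂.f

/-- `γ₁` and `γ₂` are *parallel independent*. -/
def ParallelIndependent {ρ₁ ρ₂ : WeakSpan C} {G : C}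
    (γ₁ : DirectTransformation ρ₁ G) (γ₂ : DirectTransformation ρ₂ G) : Prop :=
  ∃ (j₁ : ρ₁.L ⟶ γ₂.D) (j₂ : ρ₂.L ⟶ γ₁.D),
    j₁ ≫ γ₂.f = γ₁.m ∧ j₂ ≫ γ₁.f = γ₂.m

/-- A *parallel coherent transformation diagram* of `G` by a family `Γ = (γ_a)` of direct
transformations of `G`: objects `D₀`, `P a`, `Q` with
* `j a b : I_a ⟶ D_b`, such that `f_b ∘ j a b = f_a ∘ k_a ∘ i_a` and `j a a = k_a ∘ i_a`;
* `(D₀, (e_a))` a limit over the sink `(f_a : D_a ⟶ G)`, `e₀` being the composite `D₀ ⟶ G`;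
* `d a : I_a ⟶ D₀` the morphism with `e_b ∘ d a = j a b` for all `b`;
* `(P a, g a, n a)` a pushout over `(r_a, d a)`;
* `(Q, (h a))` a colimit over the source `(g a : D₀ ⟶ P a)`, `h₀` being the composite `D₀ ⟶ Q`.
-/
structure ParallelDiagram {G : C} {ι : Type} (Γ : ι → Step G) where
  j : ∀ a b : ι, (Γ a).1.I ⟶ (Γ b).2.D
  j_self : ∀ a, j a a = (Γ a).1.i ≫ (Γ a).2.k
  j_comm : ∀ a b, j a b ≫ (Γ b).2.f = (Γ a).1.i ≫ (Γ a).2.k ≫ (Γ a).2.f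
  {D₀ : C}
  e : ∀ a, D₀ ⟶ (Γ a).2.D
  e₀ : D₀ ⟶ G
  e_comm : ∀ a, e a ≫ (Γ a).2.f = e₀
  isLimit : Nonempty (IsLimit (WidePullbackShape.mkCone
    (F := WidePullbackShape.wideCospan G (fun a => (Γ a).2.D) (fun a => (Γ a).2.f)) e₀ e e_comm))
  d : ∀ a, (Γ a).1.I ⟶ D₀
  d_comm : ∀ a b, d a ≫ e b = j a b
  {P : ι → C}
  g : ∀ a, D₀ ⟶ P a
  n : ∀ a, (Γ a).1.R ⟶ P a
  po : ∀ a, IsPushout (Γ a).1.r (d a) (n a) (g a)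
  {Q : C}
  h : ∀ a, P a ⟶ Q
  h₀ : D₀ ⟶ Q
  h_comm : ∀ a, g a ≫ h a = h₀
  isColimit : Nonempty (IsColimit (WidePushoutShape.mkCocone
    (F := WidePushoutShape.wideSpan D₀ P g) h₀ h h_comm))

/-- `G ⇒_Γ Q`: the non-empty finite family `Γ` is pairwise parallel coherent, and there is a
parallel coherent transformation of `G` by `Γ` whose result is `Q`. -/
def ParallelYields {G : C} {ι : Type} [Finite ι] [Nonempty ι] (Γ : ι → Step G) (Q : C) : Prop :=
  (∀ a b, ParallelCoherent (Γ a).2 (Γ b).2) ∧ ∃ δ : ParallelDiagram Γ, δ.Q = Q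

/-- The family consisting of two direct transformations of `G`. -/
def pair {ρ₁ ρ₂ : WeakSpan C} {G : C}
    (γ₁ : DirectTransformation ρ₁ G) (γ₂ : DirectTransformation ρ₂ G) : Fin 2 → Step G :=
  ![⟨ρ₁, γ₁⟩, ⟨ρ₂, γ₂⟩]

end WeakSpans

namespace WeakSpans

universe v u

variable {C : Type u} [Category.{v} C]

/-! The step `γ₂` is replayed on `γ₁.H` with `δ.P 0` as its middle object. Write `D₀` for the
pullback of `γ₁.f` and `γ₂.f`. Since `γ₁.f` is in `M` and `γ₂.m` factors through it, the van Kampen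
property restricts the left pushout of `γ₂` to a pushout with corner `γ₁.D` (`isPushout_of_factor`).
Cancelling the pushout `δ.P 0` from the right pushout of `γ₁` exhibits `γ₁.H` as the pushout of `δ.P
0` and `γ₁.D` over `D₀`. Pasting these two squares gives the new left square; pasting `δ.P 1` with
the colimit `Q` gives the new right one. -/

/-- A wide pullback of a two-member family is a pullback. -/
theorem isPullback_of_isLimit_widePullback_fin_two {G D₀ : C} {D : Fin 2 → C}
    {f : ∀ a, D a ⟶ G} {e₀ : D₀ ⟶ G} {e : ∀ a, D₀ ⟶ D a} {he : ∀ a, e a ≫ f a = e₀}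
    (hl : IsLimit (WidePullbackShape.mkCone
      (F := WidePullbackShape.wideCospan G D f) e₀ e he)) :
    IsPullback (e 0) (e 1) (f 0) (f 1) := by
  have ext : ∀ {X : C} {u v : X ⟶ D₀}, u ≫ e 0 = v ≫ e 0 → u ≫ e 1 = v ≫ e 1 → u = v := by
    intro X u v h0 h1
    refine hl.hom_ext fun a => ?_
    rcases a with _ | a
    -- The leg to the base `G` is determined by the leg `e 0`.
    · change u ≫ e₀ = v ≫ e₀
      rw [← he 0, reassoc_of% h0]
    · fin_cases a
      exacts [h0, h1]
  have lift : ∀ {X : C} (x : X ⟶ D 0) (y : X ⟶ D 1), x ≫ f 0 = y ≫ f 1 →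
      ∃ u : X ⟶ D₀, u ≫ e 0 = x ∧ u ≫ e 1 = y := by
    intro X x y h
    let π : ∀ a, X ⟶ D a := Fin.cons x (Fin.cons y finZeroElim)
    let s := WidePullbackShape.mkCone (F := WidePullbackShape.wideCospan G D f) (x ≫ f 0) π
      (fun a => by fin_cases a; exacts [rfl, h.symm])
    exact ⟨hl.lift s, hl.fac s (some 0), hl.fac s (some 1)⟩
  choose φ hφ₀ hφ₁ using @lift
  exact ⟨⟨by rw [he, he]⟩, ⟨PullbackCone.IsLimit.mk _ (fun s => φ s.fst s.snd s.condition)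
    (fun s => hφ₀ _ _ _) (fun s => hφ₁ _ _ _)
    (fun s m h0 h1 => ext (h0.trans (hφ₀ _ _ _).symm) (h1.trans (hφ₁ _ _ _).symm))⟩⟩

/-- A wide pushout of a two-member family is a pushout. -/
theorem isPushout_of_isColimit_widePushout_fin_two {D₀ Q : C} {P : Fin 2 → C}
    {g : ∀ a, D₀ ⟶ P a} {h₀ : D₀ ⟶ Q} {h : ∀ a, P a ⟶ Q} {hh : ∀ a, g a ≫ h a = h₀}
    (hc : IsColimit (WidePushoutShape.mkCocone
      (F := WidePushoutShape.wideSpan D₀ P g) h₀ h hh)) :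
    IsPushout (g 0) (g 1) (h 0) (h 1) := by
  have ext : ∀ {X : C} {u v : Q ⟶ X}, h 0 ≫ u = h 0 ≫ v → h 1 ≫ u = h 1 ≫ v → u = v := by
    intro X u v h0 h1
    refine hc.hom_ext fun a => ?_
    rcases a with _ | a
    · change h₀ ≫ u = h₀ ≫ v
      rw [← hh 0, Category.assoc, Category.assoc, h0]
    · fin_cases a
      exacts [h0, h1]
  have desc : ∀ {X : C} (x : P 0 ⟶ X) (y : P 1 ⟶ X), g 0 ≫ x = g 1 ≫ y →
      ∃ u : Q ⟶ X, h 0 ≫ u = x ∧ h 1 ≫ u = y := by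
    intro X x y hxy
    let ι : ∀ a, P a ⟶ X := Fin.cons x (Fin.cons y finZeroElim)
    let s := WidePushoutShape.mkCocone (F := WidePushoutShape.wideSpan D₀ P g) (g 0 ≫ x) ι
      (fun a => by fin_cases a; exacts [rfl, hxy.symm])
    exact ⟨hc.desc s, hc.fac s (some 0), hc.fac s (some 1)⟩
  choose φ hφ₀ hφ₁ using @desc
  exact ⟨⟨by rw [hh, hh]⟩, ⟨PushoutCocone.IsColimit.mk _ (fun s => φ s.inl s.inr s.condition)
    (fun s => hφ₀ _ _ _) (fun s => hφ₁ _ _ _)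
    (fun s m h0 h1 => ext (h0.trans (hφ₀ _ _ _).symm) (h1.trans (hφ₁ _ _ _).symm))⟩⟩

/-- A commutative triangle `u ≫ p = w` with `p` mono is a pullback of `w` along `p`. -/
theorem isPullback_id_of_comp_mono {X Y Z : C} (u : X ⟶ Y) (p : Y ⟶ Z) (w : X ⟶ Z) [Mono p]
    (h : u ≫ p = w) : IsPullback u (𝟙 X) p w := by
  refine ⟨⟨by rw [h, Category.id_comp]⟩, ⟨PullbackCone.IsLimit.mk _ (fun s => s.snd)
    (fun s => ?_) (fun s => Category.comp_id _) (fun s m _ h1 => ?_)⟩⟩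
  · rw [← cancel_mono p, Category.assoc, h, s.condition]
  · rw [← h1, Category.comp_id]

namespace IsWeakAdhesiveHLR

variable {M : MorphismProperty C}

/-- A pushout square along an `M`-morphism `l`, pulled back along an `M`-morphism `p` through
which the edge `m` factors, remains a pushout with the same `l`. -/
theorem isPushout_of_factor (hM : IsWeakAdhesiveHLR M) {L K D G D₀ D₁ : C}
    {l : K ⟶ L} {k : K ⟶ D} {m : L ⟶ G} {f : D ⟶ G} (po : IsPushout l k m f) (hl : M l)
    {p : D₁ ⟶ G} (hp : M p) {e₁ : D₀ ⟶ D₁} {e₂ : D₀ ⟶ D} (pb : IsPullback e₁ e₂ p f)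
    {j : L ⟶ D₁} (hj : j ≫ p = m) {c : K ⟶ D₀} (hc₁ : c ≫ e₁ = l ≫ j) (hc₂ : c ≫ e₂ = k) :
    IsPushout l c j e₁ := by
  have := hM.mono p hp
  have he₂ : M e₂ := hM.stable_baseChange.of_isPullback pb hp
  have := hM.mono e₂ he₂
  have pbm : IsPullback j (𝟙 L) p m := isPullback_id_of_comp_mono j p m hj
  -- The cube has the given pushout as bottom face and verticals `𝟙 K`, `𝟙 L`, `e₂`, `p`. The last
  -- three are in `M`, so nothing is required of `k`; the front faces are `pbm` and `pb`, and the
  -- top face is the square sought.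
  exact (hM.weakVanKampen l k m f po hl l c j e₁ (𝟙 K) (𝟙 L) e₂ p
    (IsPullback.of_vert_isIso ⟨by simp⟩) (isPullback_id_of_comp_mono c e₂ k hc₂)
    ⟨pbm.w⟩ ⟨pb.w⟩ ⟨hc₁.symm⟩
    (.inr ⟨hM.of_isIso _ inferInstance, he₂, hp⟩)).2 ⟨pbm, pb⟩

end IsWeakAdhesiveHLR

end WeakSpans

theorem mainTheorem2 {C : Type*} [Category C] [HasBinaryCoproducts C]
    (M : MorphismProperty C)
    (hM : WeakSpans.IsWeakAdhesiveHLR M)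
    (hcop : WeakSpans.CoproductsCompatible M)
    (ρ₁ ρ₂ : WeakSpans.WeakSpan C) (hρ₁ : ρ₁.In M) (hρ₂ : ρ₂.In M)
    (G Q : C)
    (γ₁ : WeakSpans.DirectTransformation ρ₁ G) (γ₂ : WeakSpans.DirectTransformation ρ₂ G)
    (hind : WeakSpans.ParallelIndependent γ₁ γ₂)
    (hQ : WeakSpans.ParallelYields (WeakSpans.pair γ₁ γ₂) Q) :
    ∃ γ : WeakSpans.DirectTransformation ρ₂ γ₁.H, γ.Yields Q := by
  obtain ⟨-, δ, rfl⟩ := hQ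
  obtain ⟨-, j₂, -, hj₂⟩ := hind
  have hf₁ : M γ₁.f := hM.stable_cobaseChange.of_isPushout γ₁.left_po.flip hρ₁.l
  have := hM.mono _ hf₁
  let e₁ : δ.D₀ ⟶ γ₁.D := δ.e 0
  let e₂ : δ.D₀ ⟶ γ₂.D := δ.e 1
  let d₁ : ρ₁.I ⟶ δ.D₀ := δ.d 0
  let d₂ : ρ₂.I ⟶ δ.D₀ := δ.d 1
  have pb : IsPullback e₁ e₂ γ₁.f γ₂.f :=
    WeakSpans.isPullback_of_isLimit_widePullback_fin_two δ.isLimit.some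
  have poQ : IsPushout (δ.g 0) (δ.g 1) (δ.h 0) (δ.h 1) :=
    WeakSpans.isPushout_of_isColimit_widePushout_fin_two δ.isColimit.some
  let n₁ : ρ₁.R ⟶ δ.P 0 := δ.n 0
  have po₁ : IsPushout ρ₁.r d₁ n₁ (δ.g 0) := δ.po 0
  have po₂ : IsPushout ρ₂.r d₂ (δ.n 1) (δ.g 1) := δ.po 1
  have hd₁₁ : d₁ ≫ e₁ = ρ₁.i ≫ γ₁.k := (δ.d_comm 0 0).trans (δ.j_self 0)
  have hd₂₂ : d₂ ≫ e₂ = ρ₂.i ≫ γ₂.k := (δ.d_comm 1 1).trans (δ.j_self 1)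
  have hw : (ρ₂.l ≫ j₂) ≫ γ₁.f = γ₂.k ≫ γ₂.f := by
    rw [Category.assoc, hj₂, γ₂.left_po.w]
  let c : ρ₂.K ⟶ δ.D₀ := pb.lift (ρ₂.l ≫ j₂) γ₂.k hw
  have hc₁ : c ≫ e₁ = ρ₂.l ≫ j₂ := pb.lift_fst _ _ _
  have hc₂ : c ≫ e₂ = γ₂.k := pb.lift_snd _ _ _
  -- The components along `e₂` agree; those along `e₁` then agree because `γ₁.f` is mono and `e₁ ≫
  -- γ₁.f = e₂ ≫ γ₂.f`.
  have hic : ρ₂.i ≫ c = d₂ := by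
    have h₂ : (ρ₂.i ≫ c) ≫ e₂ = d₂ ≫ e₂ := by rw [Category.assoc, hc₂, hd₂₂]
    refine pb.hom_ext ?_ h₂
    rw [← cancel_mono γ₁.f, Category.assoc, Category.assoc d₂, pb.w,
      ← Category.assoc, h₂, Category.assoc]
  have poD₁ : IsPushout ρ₂.l c j₂ e₁ :=
    hM.isPushout_of_factor γ₂.left_po hρ₂.l hf₁ pb hj₂ hc₁ hc₂
  have right_po : IsPushout ρ₁.r (d₁ ≫ e₁) γ₁.n γ₁.g := hd₁₁ ▸ γ₁.right_po
  let q : δ.P 0 ⟶ γ₁.H := po₁.desc γ₁.n (e₁ ≫ γ₁.g) (by rw [right_po.w, Category.assoc])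
  have hq₁ : n₁ ≫ q = γ₁.n := po₁.inl_desc _ _ _
  have hq₂ : δ.g 0 ≫ q = e₁ ≫ γ₁.g := po₁.inr_desc _ _ _
  -- Pushout cancellation: `po₁` stacked on this square is `right_po`.
  have poH₁ : IsPushout (δ.g 0) e₁ q γ₁.g :=
    IsPushout.of_top (by rw [hq₁]; exact right_po) hq₂ po₁
  refine ⟨⟨j₂ ≫ γ₁.g, c ≫ δ.g 0, q, δ.h 0, δ.n 1 ≫ δ.h 1, ?_, ?_⟩, rfl⟩
  · exact poD₁.paste_vert poH₁.flip
  -- By `hic`, the span morphism `ρ₂.i ≫ c ≫ δ.g 0` factors through `d₂`, over which `δ.P 1` is a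
  -- pushout.
  · rw [← Category.assoc, hic]
    exact po₂.paste_vert poQ.flip
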